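/- For a unital C*-algebra $A$ and $n\ge 1$, call $(a_1,\dots,a_n)\in A^n$ left unimodular if $Aa_1+\dots+Aa_n=A$, and let $\mathrm{gsr}(A)\in\{1,2,\dots\}\cup\{+\infty\}$ (the general stable rank) be the least $n\ge 1$ such that, for every $m\ge n$, the group $GL_m(A)$ of invertible $m\times m$ matrices over $A$ acts transitively by left multiplication on the set of left unimodular vectors in $A^m$ ($+\infty$ if there is no such $n$). For a compact Hausdorff space $Y$, let $C(Y)$ be the C*-algebra of continuous functions $Y\to\mathbb{C}$. Let $X$ be a non-empty compact Hausdorff space and let $x_0\in X$ be any base point. Let $\Sigma X$ be the reduced suspension of $(X,x_0)$, that is, the quotient of $[0,1]\times X$ in which $(\{0,1\}\times X)\cup([0,1]\times\{x_0\})$ is collapsed to a point, and let $\mathbb{T}$ be the unit circle. Then $$\mathrm{gsr}(C(\mathbb{T}\times X))=\max\{\mathrm{gsr}(C(X)),\ \mathrm{gsr}(C(\Sigma X))\}.$$ -/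

import Mathlib

open scoped unitInterval

/-- A vector `a` in `A ^ n` is left unimodular if `A a₁ + ⋯ + A aₙ = A`. -/
def IsLeftUnimodular {A : Type*} [Ring A] {n : ℕ} (a : Fin n → A) : Prop :=
  ∃ b : Fin n → A, ∑ i, b i * a i = 1

/-- `GL_n(A)`, the units of `M_n(A)`, acts transitively on the left unimodular vectors in `A ^ n`
by left multiplication. -/
def GLActsTransitively (A : Type*) [Ring A] (n : ℕ) : Prop :=
  ∀ a b : Fin n → A, IsLeftUnimodular a → IsLeftUnimodular b →
    ∃ T : (Matrix (Fin n) (Fin n) A)ˣ, (T : Matrix (Fin n) (Fin n) A).mulVec a = b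

/-- The general stable rank: the least `n ≥ 1` such that `GL_m(A)` acts transitively on the left
unimodular vectors in `A ^ m` for all `m ≥ n`, and `⊤` if there is no such `n`. Only the ring
structure of `A` is involved. -/
noncomputable def generalStableRank (A : Type*) [Ring A] : ℕ∞ :=
  sInf {k : ℕ∞ | ∃ n : ℕ, k = n ∧ 1 ≤ n ∧ ∀ m : ℕ, n ≤ m → GLActsTransitively A m}

/-- The subset `{0, 1} × X ∪ [0, 1] × {x₀}` of the cylinder that is collapsed to one point in the
reduced suspension of `(X, x₀)`. -/
def suspensionBase {X : Type*} (x₀ : X) : Set (I × X) :=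
  {p | p.1 = 0 ∨ p.1 = 1 ∨ p.2 = x₀}

/-- The equivalence relation on `[0, 1] × X` generated by `(0, x) ∼ (0, x₀)`, `(1, x) ∼ (1, x₀)`
and `(s, x₀) ∼ (0, x₀)`: its only class with more than one point is `suspensionBase x₀`. -/
def suspensionSetoid {X : Type*} (x₀ : X) : Setoid (I × X) where
  r p q := p = q ∨ (p ∈ suspensionBase x₀ ∧ q ∈ suspensionBase x₀)
  iseqv :=
    { refl := fun _ => Or.inl rfl
      symm := by
        rintro p q (h | h)
        · exact Or.inl h.symm
        · exact Or.inr h.symm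
      trans := by
        rintro p q r (rfl | h) (rfl | h')
        · exact Or.inl rfl
        · exact Or.inr h'
        · exact Or.inr h
        · exact Or.inr ⟨h.1, h'.2⟩ }

/-- The reduced suspension of the pointed space `(X, x₀)`. -/
def ReducedSuspension (X : Type*) (x₀ : X) : Type _ :=
  Quotient (suspensionSetoid x₀)

/-- The reduced suspension carries the quotient topology. -/
instance {X : Type*} [TopologicalSpace X] (x₀ : X) : TopologicalSpace (ReducedSuspension X x₀) :=
  inferInstanceAs (TopologicalSpace (Quotient (suspensionSetoid x₀)))

open Matrix
open scoped ComplexOrder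

/-! The equality holds degree by degree: `GL_m` acts transitively over `C(𝕋 × X)` iff it does so
over both `C(X)` and `C(ΣX)`. By `glActsTransitively_iff_liftsToGL`, transitivity over `C(Y)` means
that nowhere vanishing maps `Y → ℂ ^ m` lift to `GL_m(ℂ)` through the first column.

Lifting passes from `𝕋 × X` to the slice `{1} × X`, and to `ΣX` by pulling back along `𝕋 × X → ΣX`
and correcting the lift by factors fixing the first basis vector until it descends
(`LiftsToGL.suspension`). Conversely, a lift over `X` makes a map on `𝕋 × X` constant on `{1} × X`,
and a loop in `GL_m(ℂ)` makes it constant on `𝕋 × {x₀}`; it then factors through `ΣX`, where it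
lifts (`LiftsToGL.circle_prod`). The loop exists because homotopic maps share an orbit and
stabilizers of vectors are path connected (`exists_GL_loop_lift`). -/

/-- Every nowhere vanishing map `Y → ℂ ^ (k + 1)` is the first column of a map `Y → GL_(k+1)(ℂ)`. -/
def LiftsToGL (Y : Type*) [TopologicalSpace Y] (k : ℕ) : Prop :=
  ∀ f : C(Y, Fin (k + 1) → ℂ), (∀ y, f y ≠ 0) →
    ∃ G : C(Y, GL (Fin (k + 1)) ℂ), ∀ y, (G y).1 *ᵥ Pi.single 0 1 = f y

/-! ### Matrices over `C(Y)` as continuous families -/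

section ContinuousFamilies

variable {n : Type*} [Fintype n] [DecidableEq n] {Y : Type*} [TopologicalSpace Y]

theorem inv_mulVec_eq {g : GL n ℂ} {v w : n → ℂ} (h : g.1 *ᵥ v = w) : (g⁻¹).1 *ᵥ w = v := by
  rw [← h, mulVec_mulVec, ← Units.val_mul, inv_mul_cancel, Units.val_one, one_mulVec]

theorem mul_mulVec_eq {g h : GL n ℂ} {u v w : n → ℂ} (hv : h.1 *ᵥ u = v) (hw : g.1 *ᵥ v = w) :
    (g * h).1 *ᵥ u = w := by
  rw [Units.val_mul, ← mulVec_mulVec, hv, hw]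

theorem GL_mulVec_ne_zero (g : GL n ℂ) {v : n → ℂ} (hv : v ≠ 0) : g.1 *ᵥ v ≠ 0 := by
  intro h
  apply hv
  rw [← inv_mulVec_eq h, mulVec_zero]

/-- A continuous family of matrices with nonzero determinants is a continuous map to `GL`. -/
theorem exists_continuousMap_GL {M : Y → Matrix n n ℂ} (hM : Continuous M)
    (hdet : ∀ y, (M y).det ≠ 0) : ∃ G : C(Y, GL n ℂ), ∀ y, (G y).1 = M y := by
  refine ⟨⟨fun y => GeneralLinearGroup.mkOfDetNeZero (M y) (hdet y), ?_⟩, fun y => rfl⟩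
  rw [Units.continuous_iff]
  refine ⟨hM, ?_⟩
  have h : (fun y => (((GeneralLinearGroup.mkOfDetNeZero (M y) (hdet y))⁻¹ : GL n ℂ) :
      Matrix n n ℂ)) = fun y => ((M y).det)⁻¹ • (M y).adjugate := by
    ext1 y
    rw [coe_units_inv, Matrix.inv_def, Ring.inverse_eq_inv']
    rfl
  rw [h]
  exact (hM.matrix_det.inv₀ hdet).smul hM.matrix_adjugate

theorem continuous_GL_mulVec {G : Y → GL n ℂ} {v : Y → n → ℂ} (hG : Continuous G)
    (hv : Continuous v) : Continuous fun y => (G y).1 *ᵥ v y :=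
  (Units.continuous_val.comp hG).matrix_mulVec hv

/-- Units of `M_n(C(Y))` are continuous maps `Y → GL_n(ℂ)`. -/
theorem exists_continuousMap_of_units (T : (Matrix n n C(Y, ℂ))ˣ) :
    ∃ G : C(Y, GL n ℂ), ∀ y i j, (G y).1 i j = T.1 i j y := by
  have hmul (M N : Matrix n n C(Y, ℂ)) (h : M * N = 1) (y : Y) :
      (M.map fun a => a y) * (N.map fun a => a y) = 1 := by
    ext i j
    have := congrArg (fun P : Matrix n n C(Y, ℂ) => P i j y) h
    simp only [mul_apply, ContinuousMap.coe_sum, Finset.sum_apply, ContinuousMap.mul_apply] at this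
    simp only [mul_apply, map_apply, this, one_apply]
    split_ifs <;> rfl
  have hcont (M : Matrix n n C(Y, ℂ)) : Continuous fun y => M.map fun a => a y :=
    continuous_matrix fun i j => (M i j).continuous
  obtain ⟨G, hG⟩ := exists_continuousMap_GL (hcont T.1) fun y h => by
    have := congrArg det (hmul _ _ T.mul_inv y)
    rw [det_mul, h, zero_mul, det_one] at this
    exact zero_ne_one this
  exact ⟨G, fun y i j => by rw [hG]; rfl⟩

theorem exists_units_of_continuousMap (G : C(Y, GL n ℂ)) :
    ∃ T : (Matrix n n C(Y, ℂ))ˣ, ∀ y i j, T.1 i j y = (G y).1 i j := by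
  have hc (H : C(Y, GL n ℂ)) (i j : n) : Continuous fun y => (H y).1 i j :=
    (Units.continuous_val.comp H.continuous).matrix_elem i j
  let M (H : C(Y, GL n ℂ)) : Matrix n n C(Y, ℂ) := Matrix.of fun i j => ⟨_, hc H i j⟩
  have hmul (H K : C(Y, GL n ℂ)) (h : H * K = 1) : M H * M K = 1 := by
    ext i j y
    have := congrArg (fun P : C(Y, GL n ℂ) => (P y).1 i j) h
    simp only [ContinuousMap.mul_apply, Units.val_mul, mul_apply] at this
    simp only [M, mul_apply, ContinuousMap.coe_sum, Finset.sum_apply, ContinuousMap.mul_apply,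
      of_apply, ContinuousMap.coe_mk, this, one_apply, ContinuousMap.one_apply, Units.val_one]
    split_ifs <;> rfl
  exact ⟨⟨M G, M G⁻¹, hmul _ _ (mul_inv_cancel G), hmul _ _ (inv_mul_cancel G)⟩, fun _ _ _ => rfl⟩

end ContinuousFamilies

/-! ### Transitivity as a lifting property -/

section Orbits

variable {Y : Type*} [TopologicalSpace Y]

theorem isLeftUnimodular_iff_forall_ne_zero {m : ℕ} (a : Fin m → C(Y, ℂ)) :
    IsLeftUnimodular a ↔ ∀ y, (fun i => a i y) ≠ 0 := by
  constructor
  · rintro ⟨b, hb⟩ y h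
    have := congrArg (fun c : C(Y, ℂ) => c y) hb
    have h' (i : Fin m) : a i y = 0 := congrFun h i
    simp [ContinuousMap.coe_sum, h'] at this
  · intro h
    -- The left inverse is the conjugate vector divided by the squared norm.
    have hne (y : Y) : ∑ i, star (a i) y * a i y ≠ 0 := by
      have := h y
      rw [ne_eq, ← dotProduct_star_self_eq_zero] at this
      simpa [dotProduct, mul_comm] using this
    have hc : Continuous fun y => ∑ i, star (a i) y * a i y := by fun_prop
    refine ⟨fun i => ⟨_, hc.inv₀ hne⟩ * star (a i), ?_⟩
    ext y
    simp only [mul_assoc, ← Finset.mul_sum]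
    simp only [ContinuousMap.mul_apply, ContinuousMap.coe_mk, ContinuousMap.coe_sum,
      Finset.sum_apply, ContinuousMap.one_apply]
    exact inv_mul_cancel₀ (hne y)

theorem mulVec_eq_iff_forall {m : ℕ} {T : (Matrix (Fin m) (Fin m) C(Y, ℂ))ˣ}
    {G : Y → GL (Fin m) ℂ} (h : ∀ y i j, T.1 i j y = (G y).1 i j) (a b : Fin m → C(Y, ℂ)) :
    T.1.mulVec a = b ↔ ∀ y, (G y).1 *ᵥ (fun i => a i y) = fun i => b i y := by
  have key (y : Y) (i : Fin m) : (T.1.mulVec a) i y = ((G y).1 *ᵥ fun i => a i y) i := by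
    simp [mulVec, dotProduct, ContinuousMap.coe_sum, h]
  constructor
  · rintro rfl y
    ext i
    exact (key y i).symm
  · intro H
    ext i y
    rw [key, H]

theorem glActsTransitively_iff_liftsToGL (k : ℕ) :
    GLActsTransitively C(Y, ℂ) (k + 1) ↔ LiftsToGL Y k := by
  constructor
  · intro H f hf
    have he (y : Y) : (fun i => (Pi.single 0 1 : Fin (k + 1) → C(Y, ℂ)) i y) = Pi.single 0 1 := by
      ext i
      by_cases hi : i = 0
      · subst hi; simp
      · simp [hi]
    obtain ⟨T, hT⟩ := H (Pi.single 0 1) (fun i => ⟨fun y => f y i, by fun_prop⟩)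
      ((isLeftUnimodular_iff_forall_ne_zero _).2 fun y h => by
        rw [he] at h
        simpa using congrFun h 0)
      ((isLeftUnimodular_iff_forall_ne_zero _).2 hf)
    obtain ⟨G, hG⟩ := exists_continuousMap_of_units T
    refine ⟨G, fun y => ?_⟩
    have := (mulVec_eq_iff_forall (fun y i j => (hG y i j).symm) _ _).1 hT y
    rwa [he] at this
  · intro H a b ha hb
    rw [isLeftUnimodular_iff_forall_ne_zero] at ha hb
    obtain ⟨G, hG⟩ := H ⟨fun y i => a i y, by fun_prop⟩ ha
    obtain ⟨K, hK⟩ := H ⟨fun y i => b i y, by fun_prop⟩ hb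
    obtain ⟨T, hT⟩ := exists_units_of_continuousMap (K * G⁻¹)
    exact ⟨T, (mulVec_eq_iff_forall hT _ _).2 fun y =>
      mul_mulVec_eq (inv_mulVec_eq (hG y)) (hK y)⟩

end Orbits

/-! ### Lifting homotopies, paths and loops to `GL` -/

section Paths

variable {n : Type*} [Fintype n] [DecidableEq n]

/-- Nowhere orthogonal nowhere vanishing maps to `ℂ ^ n` are in the same orbit. -/
theorem exists_GL_of_dotProduct_ne_zero {Y : Type*} [TopologicalSpace Y] {u v : Y → n → ℂ}
    (hu : Continuous u) (hv : Continuous v) (hu0 : ∀ y, u y ≠ 0)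
    (huv : ∀ y, star (u y) ⬝ᵥ v y ≠ 0) :
    ∃ G : C(Y, GL n ℂ), ∀ y, (G y).1 *ᵥ u y = v y := by
  have hne (y : Y) : star (u y) ⬝ᵥ u y ≠ 0 := by
    exact dotProduct_star_self_eq_zero.not.2 (hu0 y)
  have hsu : Continuous fun y => star (u y) := hu.star
  -- A rank-one perturbation of the identity sending `u` to `v`; its determinant is `⟨u, v⟩ / ⟨u,
  -- u⟩`.
  obtain ⟨G, hG⟩ := exists_continuousMap_GL
    (M := fun y => 1 + vecMulVec ((star (u y) ⬝ᵥ u y)⁻¹ • (v y - u y)) (star (u y)))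
    (continuous_const.add (((((hsu.dotProduct hu).inv₀ hne).smul (hv.sub hu))).matrix_vecMulVec hsu))
    (fun y => by
      rw [vecMulVec_eq Unit, det_one_add_replicateCol_mul_replicateRow, dotProduct_smul, dotProduct_sub, smul_eq_mul, mul_sub,
        inv_mul_cancel₀ (hne y), add_sub_cancel]
      exact mul_ne_zero (inv_ne_zero (hne y)) (huv y))
  refine ⟨G, fun y => ?_⟩
  rw [hG, add_mulVec, one_mulVec, vecMulVec_mulVec]
  ext i
  simp only [Pi.add_apply, Pi.smul_apply, smul_eq_mul, MulOpposite.smul_eq_mul_unop,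
    MulOpposite.unop_op, Pi.sub_apply]
  rw [mul_right_comm, inv_mul_cancel₀ (hne y)]
  ring

/-- Homotopic nowhere vanishing maps to `ℂ ^ n` are in the same orbit. -/
theorem exists_GL_of_homotopy {Y : Type*} [TopologicalSpace Y] [CompactSpace Y]
    (H : C(I × Y, n → ℂ)) (h0 : ∀ p, H p ≠ 0) :
    ∃ G : C(Y, GL n ℂ), ∀ y, (G y).1 *ᵥ H (0, y) = H (1, y) := by
  let R (s t : I) : Prop := ∃ G : C(Y, GL n ℂ), ∀ y, (G y).1 *ᵥ H (s, y) = H (t, y)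
  have symm {s t : I} : R s t → R t s := fun ⟨G, hG⟩ => ⟨G⁻¹, fun y => inv_mulVec_eq (hG y)⟩
  have trans {r s t : I} : R r s → R s t → R r t := fun ⟨G, hG⟩ ⟨K, hK⟩ =>
    ⟨K * G, fun y => mul_mulVec_eq (hG y) (hK y)⟩
  have near (s : I) : ∀ᶠ t in nhds s, R s t := by
    have hc : Continuous fun p : I × Y => star (H (s, p.2)) ⬝ᵥ H p :=
      Continuous.dotProduct (Continuous.star (by fun_prop)) (by fun_prop)
    -- Compactness of `Y` gives one neighbourhood of `s` that works for all `y` at once.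
    have hcl : IsClosed (Prod.fst '' {p : I × Y | star (H (s, p.2)) ⬝ᵥ H p = 0}) :=
      isClosedMap_fst_of_compactSpace _ (isClosed_eq hc continuous_const)
    have hs : s ∈ (Prod.fst '' {p : I × Y | star (H (s, p.2)) ⬝ᵥ H p = 0})ᶜ := by
      rintro ⟨⟨s', y⟩, h, rfl⟩
      exact h0 (s', y) (by
        have h : star (H (s', y)) ⬝ᵥ H (s', y) = 0 := h
        rwa [dotProduct_star_self_eq_zero] at h)
    filter_upwards [hcl.isOpen_compl.mem_nhds hs] with t ht
    exact exists_GL_of_dotProduct_ne_zero (by fun_prop) (by fun_prop) (fun y => h0 _)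
      fun y hy => ht ⟨(t, y), hy, rfl⟩
  have hclopen : IsClopen {t : I | R 0 t} := by
    constructor
    · rw [← isOpen_compl_iff, isOpen_iff_mem_nhds]
      intro s hs
      filter_upwards [near s] with t ht h
      exact hs (trans h (symm ht))
    · rw [isOpen_iff_mem_nhds]
      intro s hs
      filter_upwards [near s] with t ht
      exact trans hs ht
  have huniv := hclopen.eq_univ ⟨0, (near 0).self_of_nhds⟩
  exact (Set.ext_iff.1 huniv 1).2 trivial

/-- Paths of nonzero vectors lift to `GL`. -/
theorem exists_GL_path_lift (c : C(I, n → ℂ)) (h0 : ∀ t, c t ≠ 0) :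
    ∃ G : C(I, GL n ℂ), ∀ t, (G t).1 *ᵥ c 0 = c t := by
  -- Contract the path to its starting point.
  obtain ⟨G, hG⟩ := exists_GL_of_homotopy ⟨fun p : I × I => c (p.1 * p.2), by fun_prop⟩
    fun p => h0 _
  exact ⟨G, fun t => by simpa using hG t⟩

/-- The determinant is a polynomial in `z` with value `1` at `z = 0`. -/
theorem finite_setOf_det_eq_zero (A : GL n ℂ) :
    {z : ℂ | (z • A.1 + (1 - z) • (1 : Matrix n n ℂ)).det = 0}.Finite := by
  let M : Matrix n n (Polynomial ℂ) :=
    (Polynomial.X : Polynomial ℂ) • A.1.map Polynomial.C + (1 - Polynomial.X : Polynomial ℂ) • 1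
  have heval (z : ℂ) : M.det.eval z = (z • A.1 + (1 - z) • (1 : Matrix n n ℂ)).det := by
    rw [← Polynomial.coe_evalRingHom, RingHom.map_det]
    congr 1
    ext i j
    by_cases hij : i = j
    · subst hij; simp [M, mul_comm z]
    · simp [M, hij, mul_comm z]
  have hM : M.det ≠ 0 := by
    intro h
    have := heval 0
    simp [h] at this
  refine (Polynomial.finite_setOfPred_isRoot hM).subset fun z hz => ?_
  rw [Set.mem_ofPred_eq, Polynomial.IsRoot, heval]
  exact hz

/-- Stabilizers of vectors in `GL_n(ℂ)` are path connected. -/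
theorem exists_path_in_stabilizer (A : GL n ℂ) {v : n → ℂ} (hA : A.1 *ᵥ v = v) :
    ∃ S : C(I, GL n ℂ), S 0 = 1 ∧ S 1 = A ∧ ∀ t, (S t).1 *ᵥ v = v := by
  -- The complex line through `1` and `A` fixes `v`, and its singular points are finitely many, so a
  -- path from `0` to `1` in the parameter plane avoids them.
  have hpc : IsPathConnected {z : ℂ | (z • A.1 + (1 - z) • (1 : Matrix n n ℂ)).det = 0}ᶜ :=
    (finite_setOf_det_eq_zero A).countable.isPathConnected_compl_of_one_lt_rank
      (by rw [Complex.rank_real_complex]; norm_num)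
  obtain ⟨γ, hγ⟩ := hpc.joinedIn 0 (by simp) 1 (by simpa using A.isUnit.map detMonoidHom |>.ne_zero)
  obtain ⟨S, hS⟩ := exists_continuousMap_GL
    (M := fun t : I => γ t • A.1 + (1 - γ t) • (1 : Matrix n n ℂ)) (by fun_prop) hγ
  refine ⟨S, Units.ext ?_, Units.ext ?_, fun t => ?_⟩
  · rw [hS]; simp
  · rw [hS]; simp
  · rw [hS, add_mulVec, smul_mulVec, smul_mulVec, hA, one_mulVec, ← add_smul,
      add_sub_cancel, one_smul]

/-- Loops of nonzero vectors lift to loops in `GL`. -/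
theorem exists_GL_loop_lift (c : C(I, n → ℂ)) (h0 : ∀ t, c t ≠ 0) (h : c 0 = c 1) :
    ∃ L : C(I, GL n ℂ), L 0 = L 1 ∧ ∀ t, (L t).1 *ᵥ c 0 = c t := by
  obtain ⟨G, hG⟩ := exists_GL_path_lift c h0
  obtain ⟨S, hS0, hS1, hS⟩ := exists_path_in_stabilizer ((G 0)⁻¹ * G 1) (v := c 0)
    (mul_mulVec_eq ((hG 1).trans h.symm) (inv_mulVec_eq (hG 0)))
  -- Right multiplication by the stabilizer path keeps the lift and moves its endpoint `G 1` to `G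
  -- 0`.
  refine ⟨G * S⁻¹, ?_, fun t => mul_mulVec_eq (inv_mulVec_eq (hS t)) (hG t)⟩
  simp [hS0, hS1]

end Paths

/-! ### Descending maps from the cylinder -/

section Suspension

variable {X : Type*} [TopologicalSpace X] {Z : Type*} [TopologicalSpace Z]

/-- The quotient map from the cylinder to the reduced suspension. -/
def suspensionMk (x₀ : X) : C(I × X, ReducedSuspension X x₀) :=
  ⟨Quotient.mk (suspensionSetoid x₀), continuous_quotient_mk'⟩

theorem suspensionMk_surjective (x₀ : X) : Function.Surjective (suspensionMk x₀) :=
  Quotient.mk_surjective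

theorem suspensionMk_eq (x₀ : X) {p q : I × X} (hp : p ∈ suspensionBase x₀)
    (hq : q ∈ suspensionBase x₀) : suspensionMk x₀ p = suspensionMk x₀ q :=
  Quotient.sound (Or.inr ⟨hp, hq⟩)

theorem exists_suspension_desc (x₀ : X) (f : C(I × X, Z)) (z : Z)
    (hf : ∀ p ∈ suspensionBase x₀, f p = z) :
    ∃ g : C(ReducedSuspension X x₀, Z), ∀ p, g (suspensionMk x₀ p) = f p := by
  have h : ∀ p q : I × X, (suspensionSetoid x₀).r p q → f p = f q := by
    rintro p q (rfl | ⟨hp, hq⟩)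
    · rfl
    · rw [hf p hp, hf q hq]
  exact ⟨⟨Quotient.lift f h, f.continuous.quotient_lift h⟩, fun p => rfl⟩

/-- The map `(t, x) ↦ (exp (2πit), x)` from the cylinder over `X` to `𝕋 × X`. -/
noncomputable def cylinderToCircleProd (X : Type*) [TopologicalSpace X] : C(I × X, Circle × X) :=
  ⟨fun p => (Circle.exp (2 * Real.pi * p.1), p.2), by fun_prop⟩

theorem cylinderToCircleProd_zero (x : X) : cylinderToCircleProd X (0, x) = (1, x) := by
  simp [cylinderToCircleProd]

theorem cylinderToCircleProd_one (x : X) : cylinderToCircleProd X (1, x) = (1, x) := by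
  simp [cylinderToCircleProd]

theorem Circle.exp_eq_exp_of_mem_unitInterval {s t : I}
    (h : Circle.exp (2 * Real.pi * s) = Circle.exp (2 * Real.pi * t)) :
    s = t ∨ (s = 0 ∧ t = 1) ∨ (s = 1 ∧ t = 0) := by
  obtain ⟨m, hm⟩ := Circle.exp_eq_exp.1 h
  have hst : (s : ℝ) = t + m := by
    have := Real.pi_pos
    apply mul_left_cancel₀ (show 2 * Real.pi ≠ 0 by positivity)
    linarith
  have h1 := s.2.1
  have h2 := s.2.2
  have h3 := t.2.1
  have h4 := t.2.2
  have hm1 : m ≤ 1 := by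
    have : (m : ℝ) ≤ 1 := by linarith
    exact_mod_cast this
  have hm2 : -1 ≤ m := by
    have : (-1 : ℝ) ≤ m := by linarith
    exact_mod_cast this
  interval_cases m
  · push_cast at hst
    refine Or.inr (Or.inl ⟨Subtype.ext ?_, Subtype.ext ?_⟩) <;>
      simp only [Set.Icc.coe_zero, Set.Icc.coe_one] <;> linarith
  · exact Or.inl (Subtype.ext (by simpa using hst))
  · push_cast at hst
    refine Or.inr (Or.inr ⟨Subtype.ext ?_, Subtype.ext ?_⟩) <;>
      simp only [Set.Icc.coe_zero, Set.Icc.coe_one] <;> linarith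

theorem cylinderToCircleProd_surjective : Function.Surjective (cylinderToCircleProd X) := by
  rintro ⟨w, x⟩
  obtain ⟨θ, rfl⟩ := Circle.exp_surjective w
  have hpi := Real.two_pi_pos
  refine ⟨(⟨Int.fract (θ / (2 * Real.pi)), Int.fract_nonneg _, (Int.fract_lt_one _).le⟩, x), ?_⟩
  refine Prod.ext (Circle.exp_eq_exp.2 ⟨-⌊θ / (2 * Real.pi)⌋, ?_⟩) rfl
  simp only [Int.fract, Int.cast_neg]
  field_simp
  ring

variable [CompactSpace X] [T2Space X]

/-- The cylinder is compact and `𝕋 × X` Hausdorff, so the surjection between them is closed, hence a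
quotient map. -/
theorem exists_circleProd_desc (f : C(I × X, Z)) (hf : ∀ x, f (0, x) = f (1, x)) :
    ∃ g : C(Circle × X, Z), ∀ p, g (cylinderToCircleProd X p) = f p := by
  have hq : Topology.IsQuotientMap (cylinderToCircleProd X) :=
    (cylinderToCircleProd X).continuous.isClosedMap.isQuotientMap
      (cylinderToCircleProd X).continuous cylinderToCircleProd_surjective
  have h : Function.FactorsThrough f (cylinderToCircleProd X) := by
    rintro ⟨s, x⟩ ⟨t, y⟩ hst
    obtain ⟨h1, h2⟩ := Prod.ext_iff.1 hst
    obtain rfl : x = y := h2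
    obtain rfl | ⟨rfl, rfl⟩ | ⟨rfl, rfl⟩ := Circle.exp_eq_exp_of_mem_unitInterval h1
    · rfl
    · exact hf x
    · exact (hf x).symm
  exact ⟨hq.lift f h, fun p => DFunLike.congr_fun (hq.lift_comp f h) p⟩

end Suspension

/-! ### Comparing `𝕋 × X` with `X` and `ΣX` -/

section Main

variable {X : Type*} [TopologicalSpace X]

theorem LiftsToGL.of_circle_prod {k : ℕ} (H : LiftsToGL (Circle × X) k) : LiftsToGL X k := by
  intro f hf
  obtain ⟨G, hG⟩ := H (f.comp ContinuousMap.snd) fun p => hf p.2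
  exact ⟨⟨fun x => G (1, x), by fun_prop⟩, fun x => hG (1, x)⟩

variable [CompactSpace X] [T2Space X]

theorem LiftsToGL.suspension {k : ℕ} (H : LiftsToGL (Circle × X) k) (x₀ : X) :
    LiftsToGL (ReducedSuspension X x₀) k := by
  intro f hf
  obtain ⟨q, hq⟩ := exists_circleProd_desc (suspensionMk x₀) fun x =>
    suspensionMk_eq x₀ (Or.inl rfl) (Or.inr (Or.inl rfl))
  obtain ⟨G, hG⟩ := H (f.comp q) fun p => hf _
  let g : C(I × X, GL (Fin (k + 1)) ℂ) := G.comp (cylinderToCircleProd X)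
  have hg (p : I × X) : (g p).1 *ᵥ Pi.single 0 1 = f (suspensionMk x₀ p) :=
    (hG _).trans (congrArg f (hq p))
  have hg01 (x : X) : g (1, x) = g (0, x) := by
    simp only [g, ContinuousMap.comp_apply, cylinderToCircleProd_zero, cylinderToCircleProd_one]
  have hgb {p : I × X} (hp : p ∈ suspensionBase x₀) :
      (g p).1 *ᵥ Pi.single 0 1 = f (suspensionMk x₀ (0, x₀)) := by
    rw [hg, suspensionMk_eq x₀ hp (q := (0, x₀)) (Or.inl rfl)]
  -- On the base all values of `g` have the same first column, so the factors after `g p` fix the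
  -- first basis vector together; they are chosen to make the product constant on the base.
  obtain ⟨K, hK⟩ := exists_suspension_desc x₀
    ⟨fun p : I × X => g p * (g (0, p.2))⁻¹ * g (0, x₀) * (g (p.1, x₀))⁻¹ * g (0, x₀), by fun_prop⟩
    (g (0, x₀)) (by
      rintro ⟨t, x⟩ (h | h | h)
      · obtain rfl : t = 0 := h
        simp
      · obtain rfl : t = 1 := h
        simp [hg01]
      · obtain rfl : x = x₀ := h
        simp)
  refine ⟨K, fun y => ?_⟩
  obtain ⟨p, rfl⟩ := suspensionMk_surjective x₀ y
  rw [hK]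
  have h0 : ((0 : I), x₀) ∈ suspensionBase x₀ := Or.inl rfl
  have h1 : ((0 : I), p.2) ∈ suspensionBase x₀ := Or.inl rfl
  have h2 : (p.1, x₀) ∈ suspensionBase x₀ := Or.inr (Or.inr rfl)
  exact mul_mulVec_eq (hgb h0) <|
    mul_mulVec_eq (inv_mulVec_eq (hgb h2)) <|
    mul_mulVec_eq (hgb h0) <|
    mul_mulVec_eq (inv_mulVec_eq (hgb h1)) (hg p)

theorem LiftsToGL.circle_prod {k : ℕ} (hX : LiftsToGL X k) {x₀ : X}
    (hS : LiftsToGL (ReducedSuspension X x₀) k) : LiftsToGL (Circle × X) k := by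
  intro f hf
  obtain ⟨g, hg⟩ := hX ⟨fun x => f (1, x), by fun_prop⟩ fun x => hf _
  let F : C(I × X, Fin (k + 1) → ℂ) :=
    ⟨fun p => ((g p.2)⁻¹).1 *ᵥ f (cylinderToCircleProd X p),
      continuous_GL_mulVec (by fun_prop) (by fun_prop)⟩
  have hF (p : I × X) : F p ≠ 0 := GL_mulVec_ne_zero _ (hf _)
  have hF0 (x : X) : F (0, x) = Pi.single 0 1 := by
    simp only [F, ContinuousMap.coe_mk, cylinderToCircleProd_zero]
    exact inv_mulVec_eq (hg x)
  have hF1 (x : X) : F (1, x) = Pi.single 0 1 := by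
    simp only [F, ContinuousMap.coe_mk, cylinderToCircleProd_one]
    exact inv_mulVec_eq (hg x)
  obtain ⟨L, hL01, hL⟩ := exists_GL_loop_lift ⟨fun t => F (t, x₀), by fun_prop⟩ (fun t => hF _)
    ((hF0 x₀).trans (hF1 x₀).symm)
  simp only [ContinuousMap.coe_mk, hF0] at hL
  have hL0 := (hL 0).trans (hF0 x₀)
  have hL1 := (hL 1).trans (hF1 x₀)
  let F' : C(I × X, Fin (k + 1) → ℂ) :=
    ⟨fun p => ((L p.1)⁻¹).1 *ᵥ F p, continuous_GL_mulVec (by fun_prop) (by fun_prop)⟩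
  obtain ⟨f', hf'⟩ := exists_suspension_desc x₀ F' (Pi.single 0 1) (by
    rintro ⟨t, x⟩ (h | h | h)
    · obtain rfl : t = 0 := h
      simp only [F', ContinuousMap.coe_mk, hF0]
      exact inv_mulVec_eq hL0
    · obtain rfl : t = 1 := h
      simp only [F', ContinuousMap.coe_mk, hF1]
      exact inv_mulVec_eq hL1
    · obtain rfl : x = x₀ := h
      exact inv_mulVec_eq (hL t))
  obtain ⟨K, hK⟩ := hS f' fun y => by
    obtain ⟨p, rfl⟩ := suspensionMk_surjective x₀ y
    rw [hf']
    exact GL_mulVec_ne_zero _ (hF p)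
  -- Undo both normalizations; the product closes up because `L` is a loop, not merely a path.
  obtain ⟨G, hG⟩ := exists_circleProd_desc
    ⟨fun p : I × X => g p.2 * (L p.1 * K (suspensionMk x₀ p)), by fun_prop⟩ fun x => by
      simp only [ContinuousMap.coe_mk, hL01,
        suspensionMk_eq x₀ (p := (0, x)) (q := (1, x)) (Or.inl rfl) (Or.inr (Or.inl rfl))]
  refine ⟨G, fun y => ?_⟩
  obtain ⟨p, rfl⟩ := cylinderToCircleProd_surjective y
  rw [hG]
  have hLF : (L p.1).1 *ᵥ F' p = F p := by
    have := inv_mulVec_eq (g := (L p.1)⁻¹) (v := F p) rfl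
    rwa [inv_inv] at this
  have hgF : (g p.2).1 *ᵥ F p = f (cylinderToCircleProd X p) := by
    have := inv_mulVec_eq (g := (g p.2)⁻¹) (v := f (cylinderToCircleProd X p)) rfl
    rwa [inv_inv] at this
  exact mul_mulVec_eq (mul_mulVec_eq ((hK _).trans (hf' p)) hLF) hgF

theorem glActsTransitively_zero (A : Type*) [Ring A] : GLActsTransitively A 0 :=
  fun _ _ _ _ => ⟨1, Subsingleton.elim _ _⟩

theorem glActsTransitively_circle_prod_iff (x₀ : X) (m : ℕ) :
    GLActsTransitively C(Circle × X, ℂ) m ↔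
      GLActsTransitively C(X, ℂ) m ∧ GLActsTransitively C(ReducedSuspension X x₀, ℂ) m := by
  cases m with
  | zero => simp only [glActsTransitively_zero, and_self]
  | succ k =>
    simp only [glActsTransitively_iff_liftsToGL]
    exact ⟨fun H => ⟨H.of_circle_prod, H.suspension x₀⟩, fun H => H.1.circle_prod H.2⟩

theorem generalStableRank_le {A : Type*} [Ring A] {n : ℕ} (hn : 1 ≤ n)
    (h : ∀ m : ℕ, n ≤ m → GLActsTransitively A m) : generalStableRank A ≤ n :=
  sInf_le ⟨n, rfl, hn, h⟩

theorem generalStableRank_eq_top_or (A : Type*) [Ring A] :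
    generalStableRank A = ⊤ ∨ ∃ n : ℕ, generalStableRank A = n ∧ 1 ≤ n ∧
      ∀ m : ℕ, n ≤ m → GLActsTransitively A m := by
  rw [generalStableRank]
  obtain h | h := Set.eq_empty_or_nonempty {k : ℕ∞ | ∃ n : ℕ, k = n ∧ 1 ≤ n ∧
    ∀ m : ℕ, n ≤ m → GLActsTransitively A m}
  · exact Or.inl (by rw [h, sInf_empty])
  · exact Or.inr (csInf_mem h)

theorem generalStableRank_mono {A B : Type*} [Ring A] [Ring B]
    (h : ∀ m, GLActsTransitively A m → GLActsTransitively B m) :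
    generalStableRank B ≤ generalStableRank A := by
  obtain hA | ⟨n, hA, hn, H⟩ := generalStableRank_eq_top_or A
  · rw [hA]
    exact le_top
  · rw [hA]
    exact generalStableRank_le hn fun m hm => h m (H m hm)

theorem generalStableRank_eq_max {A B C : Type*} [Ring A] [Ring B] [Ring C]
    (h : ∀ m, GLActsTransitively A m ↔ GLActsTransitively B m ∧ GLActsTransitively C m) :
    generalStableRank A = max (generalStableRank B) (generalStableRank C) := by
  refine le_antisymm ?_ (max_le (generalStableRank_mono fun m H => ((h m).1 H).1)
    (generalStableRank_mono fun m H => ((h m).1 H).2))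
  obtain hB | ⟨n, hB, hn, HB⟩ := generalStableRank_eq_top_or B
  · rw [hB, max_eq_left le_top]
    exact le_top
  obtain hC | ⟨l, hC, -, HC⟩ := generalStableRank_eq_top_or C
  · rw [hC, max_eq_right le_top]
    exact le_top
  rw [hB, hC, ← Nat.mono_cast.map_max]
  exact generalStableRank_le (hn.trans (le_max_left n l)) fun m hm =>
    (h m).2 ⟨HB m ((le_max_left n l).trans hm), HC m ((le_max_right n l).trans hm)⟩

end Main

theorem mainTheorem9 {X : Type*} [TopologicalSpace X] [CompactSpace X] [T2Space X] (x₀ : X) :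
    generalStableRank C(Circle × X, ℂ) =
      max (generalStableRank C(X, ℂ)) (generalStableRank C(ReducedSuspension X x₀, ℂ)) :=
  generalStableRank_eq_max fun m => glActsTransitively_circle_prod_iff x₀ m
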